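/- All manifolds, functions, forms and vector fields are smooth ($C^\infty$) and real. Let $V$ be a manifold and $\mathcal R\subset TV$ a distribution of constant rank. Let $A_{\mathcal R}=\{f\in C^\infty(V) : Z(f)=0 \text{ for all } Z \text{ in } \mathcal R\}$. Let $L_{\mathcal R}$ be the set of smooth sections $s$ of the quotient bundle $TV/\mathcal R$ that are invariant along $\mathcal R$, i.e. such that $[Z,X]$ is a section of $\mathcal R$ for every vector field $X$ on an open set $U$ representing $s|_U$ and every section $Z$ of $\mathcal R$ over $U$. (If $\mathcal R$ is spanned by the first coordinate fields $\partial/\partial x_1,\dots,\partial/\partial x_p$ of a chart, this says that the coefficients of $s$ on the remaining coordinate fields have vanishing derivatives with respect to $x_1,\dots,x_p$.) We say that $\mathcal R$ *induces a Lie–Rinehart algebra* if the pair $(L_{\mathcal R},A_{\mathcal R})$, with pointwise addition and multiplications, the bracket $[\overline X,\overline Y]=\overline{[X,Y]}$ (computed with arbitrary local representatives $X,Y$ of the two sections) and the action $\overline X\cdot f=X(f)$, is a well-defined Lie–Rinehart algebra over $\mathbb R$: $A_{\mathcal R}$ is a commutative associative $\mathbb R$-algebra, $L_{\mathcal R}$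 is a real Lie algebra and an $A_{\mathcal R}$-module, $\overline X\mapsto(f\mapsto \overline X\cdot f)$ is a morphism of Lie algebras from $L_{\mathcal R}$ to the derivations of $A_{\mathcal R}$, and $$[\overline X,f\overline Y]=f[\overline X,\overline Y]+(\overline X\cdot f)\,\overline Y,\qquad (f\overline X)\cdot g=f\,(\overline X\cdot g).$$ (1) Let $\omega$ be a contact form on a manifold $V$ of dimension $2p+1$, i.e. a $1$-form with $\omega\wedge(d\omega)^p\neq0$ at every point, and let $R$ be its Reeb field, i.e. the vector field with $\omega(R)=1$ and $d\omega(R,\cdot)=0$. Then the line distribution $\langle R\rangle$ induces a Lie–Rinehart algebra $(L,A)$: here $L$ consists of the invariant sections of $E(\omega)=TV/\langle R\rangle$, and $A$ of the functions $f$ with $R(f)=0$. (2) Let $V$ be a manifold of dimension $n$ and $\mathcal P\subset T^*V$ a $p$-contact system: a Pfaffian system (subbundle) of rank $p$ which is of maximal class $n$ at every point $x$ (that is, $\mathcal P_x$ and the forms $d\alpha(v,\cdot)$, for $\alpha$ a local section of $\mathcal P$ and $v\in T_xV$ annihilated by $\mathcal P_x$, together span $T_x^*V$) and which has an integral submanifold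 of dimension $q=\frac{p(n-p)}{p+1}$ through every point. Let $m$ be a non-negative integer and let $\mathcal R\subset TV$ be a distribution such that around every point there is a Darboux chart of $\mathcal P$, with coordinates $x_i,y_j,z_{ji}$ ($1\le i\le p$, $1\le j\le m$, so $n=p+m+pm$) in which $\mathcal P$ is spanned by the forms $$\alpha_i=dx_i+\sum_{j=1}^m z_{ji}\,dy_j\qquad(1\le i\le p),$$ and in which $\mathcal R$ is spanned by $\partial/\partial x_1,\dots,\partial/\partial x_p$. Then $\mathcal R$ induces a Lie–Rinehart algebra $(L_{\mathcal R},A_{\mathcal R})$, on invariant sections of $P=TV/\mathcal R$ and on the functions $C^\infty_{\mathcal R}=A_{\mathcal R}$. -/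

import Mathlib

open Set Bundle
open scoped Manifold ContDiff

noncomputable section

namespace LieRinehartContact

section Basics

variable {n : ℕ} {V : Type*} [TopologicalSpace V] [ChartedSpace (EuclideanSpace ℝ (Fin n)) V]
  [IsManifold (𝓡 n) ∞ V]

/-! ### Vector fields, one-forms and the exterior derivative of a one-form -/

/-- The vector field `X` is smooth on the set `U`. -/
def SmoothFieldOn (X : ∀ x : V, TangentSpace (𝓡 n) x) (U : Set V) : Prop :=
  ContMDiffOn (𝓡 n) (𝓡 n).tangent ∞ (fun x => (⟨x, X x⟩ : TangentBundle (𝓡 n) V)) U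

/-- The differential one-form `α` is smooth on the set `U`, as a section of the bundle of
linear forms on the tangent bundle. -/
def SmoothFormOn
    (α : ∀ x : V, TangentSpace (𝓡 n) x →L[ℝ] ℝ) (U : Set V) : Prop :=
  ContMDiffOn (𝓡 n) ((𝓡 n).prod 𝓘(ℝ, EuclideanSpace ℝ (Fin n) →L[ℝ] ℝ)) ∞
    (fun x => TotalSpace.mk' (EuclideanSpace ℝ (Fin n) →L[ℝ] ℝ)
      (E := fun x : V => TangentSpace (𝓡 n) x →L[ℝ] Bundle.Trivial V ℝ x) x (α x)) U

/-- The expression of the one-form `α` in the preferred chart around `x`: the pullback of `α`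
under the inverse of this chart. -/
def formInChart (α : ∀ x : V, TangentSpace (𝓡 n) x →L[ℝ] ℝ) (x : V)
    (u : EuclideanSpace ℝ (Fin n)) : EuclideanSpace ℝ (Fin n) →L[ℝ] ℝ :=
  (α ((chartAt (EuclideanSpace ℝ (Fin n)) x).symm u)).comp
    (mfderiv (𝓡 n) (𝓡 n) (chartAt (EuclideanSpace ℝ (Fin n)) x).symm u)

/-- The exterior derivative `dα` of a one-form at the point `x`, computed in the preferred chart
`φ` around `x` and carried back by `dφ_x`; the convention is
`dα(X, Y) = X(α(Y)) - Y(α(X)) - α([X, Y])`. -/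
def extDerivForm (α : ∀ x : V, TangentSpace (𝓡 n) x →L[ℝ] ℝ) (x : V) :
    TangentSpace (𝓡 n) x →L[ℝ] TangentSpace (𝓡 n) x →L[ℝ] ℝ :=
  let φ := chartAt (EuclideanSpace ℝ (Fin n)) x
  let D : EuclideanSpace ℝ (Fin n) →L[ℝ] EuclideanSpace ℝ (Fin n) →L[ℝ] ℝ :=
    fderiv ℝ (formInChart α x) (φ x)
  let dφ : EuclideanSpace ℝ (Fin n) →L[ℝ] EuclideanSpace ℝ (Fin n) := mfderiv (𝓡 n) (𝓡 n) φ x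
  (D - D.flip).bilinearComp dφ dφ

/-! ### The Lie-Rinehart pair attached to a distribution

For a distribution `ℛ` (a family of subspaces `ℛ x` of the tangent spaces), the fibre at `x` of the
quotient bundle is `T_x V ⧸ ℛ x`. -/

/-- The vector field `X` represents on `U` the section `s` of the quotient bundle `TV / ℛ`. -/
def Represents {ℛ : ∀ x : V, Submodule ℝ (TangentSpace (𝓡 n) x)}
    (X : ∀ x : V, TangentSpace (𝓡 n) x) (s : ∀ x : V, TangentSpace (𝓡 n) x ⧸ ℛ x)
    (U : Set V) : Prop :=
  ∀ y ∈ U, (ℛ y).mkQ (X y) = s y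

/-- A section of the quotient bundle `TV / ℛ` is smooth when it is locally represented by smooth
vector fields. -/
def IsSmoothSection {ℛ : ∀ x : V, Submodule ℝ (TangentSpace (𝓡 n) x)}
    (s : ∀ x : V, TangentSpace (𝓡 n) x ⧸ ℛ x) : Prop :=
  ∀ x : V, ∃ U : Set V, IsOpen U ∧ x ∈ U ∧
    ∃ X : ∀ x : V, TangentSpace (𝓡 n) x, SmoothFieldOn X U ∧ Represents X s U

/-- The section `s` of `TV / ℛ` is invariant along `ℛ`: for every local representative `X` of `s`
and every local section `Z` of `ℛ`, the bracket `[Z, X]` lies in `ℛ`. In coordinates in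
which `ℛ` is spanned by the first coordinate fields, this says that the coefficients of `s` on the
other coordinate fields do not depend on the first coordinates. It is the condition under which
`[X, Y]` modulo `ℛ` depends on `Y` modulo `ℛ` only. -/
def IsInvariantSection {ℛ : ∀ x : V, Submodule ℝ (TangentSpace (𝓡 n) x)}
    (s : ∀ x : V, TangentSpace (𝓡 n) x ⧸ ℛ x) : Prop :=
  ∀ U : Set V, IsOpen U → ∀ X Z : (∀ x : V, TangentSpace (𝓡 n) x),
    SmoothFieldOn X U → SmoothFieldOn Z U → Represents X s U → (∀ y ∈ U, Z y ∈ ℛ y) →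
      ∀ y ∈ U, VectorField.mlieBracket (𝓡 n) Z X y ∈ ℛ y

/-- The set `L` of smooth invariant sections of the quotient bundle `TV / ℛ`. -/
structure InvariantSection (ℛ : ∀ x : V, Submodule ℝ (TangentSpace (𝓡 n) x)) where
  val : ∀ x : V, TangentSpace (𝓡 n) x ⧸ ℛ x
  smooth : IsSmoothSection val
  invariant : IsInvariantSection val

/-- The algebra `A` of smooth functions `f` on `V` with `Z(f) = 0` for every `Z` in `ℛ`. -/
def invariantFunctions (ℛ : ∀ x : V, Submodule ℝ (TangentSpace (𝓡 n) x)) :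
    Subalgebra ℝ C^∞⟮𝓡 n, V; ℝ⟯ where
  carrier := {f | ∀ x : V, ∀ v ∈ ℛ x, mfderiv (𝓡 n) 𝓘(ℝ, ℝ) f x v = 0}
  mul_mem' := by
    intro f g hf hg x v hv
    have h1 : MDifferentiableAt (𝓡 n) 𝓘(ℝ, ℝ) f x := f.contMDiff.mdifferentiableAt (by simp)
    have h2 : MDifferentiableAt (𝓡 n) 𝓘(ℝ, ℝ) g x := g.contMDiff.mdifferentiableAt (by simp)
    have h := (h1.hasMFDerivAt.mul h2.hasMFDerivAt).mfderiv
    let df : TangentSpace (𝓡 n) x →L[ℝ] ℝ := mfderiv (𝓡 n) 𝓘(ℝ, ℝ) f x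
    let dg : TangentSpace (𝓡 n) x →L[ℝ] ℝ := mfderiv (𝓡 n) 𝓘(ℝ, ℝ) g x
    have e1 : df v = 0 := hf x v hv
    have e2 : dg v = 0 := hg x v hv
    rw [ContMDiffMap.coe_mul, h]
    change f x * dg v + g x * df v = 0
    rw [e1, e2, mul_zero, mul_zero, add_zero]
  add_mem' := by
    intro f g hf hg x v hv
    have h1 : MDifferentiableAt (𝓡 n) 𝓘(ℝ, ℝ) f x := f.contMDiff.mdifferentiableAt (by simp)
    have h2 : MDifferentiableAt (𝓡 n) 𝓘(ℝ, ℝ) g x := g.contMDiff.mdifferentiableAt (by simp)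
    have h := (h1.hasMFDerivAt.add h2.hasMFDerivAt).mfderiv
    let df : TangentSpace (𝓡 n) x →L[ℝ] ℝ := mfderiv (𝓡 n) 𝓘(ℝ, ℝ) f x
    let dg : TangentSpace (𝓡 n) x →L[ℝ] ℝ := mfderiv (𝓡 n) 𝓘(ℝ, ℝ) g x
    have e1 : df v = 0 := hf x v hv
    have e2 : dg v = 0 := hg x v hv
    rw [ContMDiffMap.coe_add, h]
    change df v + dg v = 0
    rw [e1, e2, add_zero]
  algebraMap_mem' := by
    intro r x v hv
    have h : mfderiv (𝓡 n) 𝓘(ℝ, ℝ) (fun _ : V => r) x = 0 := mfderiv_const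
    change mfderiv (𝓡 n) 𝓘(ℝ, ℝ) (fun _ : V => r) x v = 0
    rw [h]
    rfl

/-- The pair `(L, A)` of the invariant sections of `TV / ℛ` and of the functions annihilated by
`ℛ` is a Lie-Rinehart algebra over `ℝ` for the following operations: the pointwise ones
on sections and functions, the bracket `[X mod ℛ, Y mod ℛ] = [X, Y] mod ℛ`, and the
action `(X mod ℛ) · f = X(f)`. -/
def InducesLieRinehart (ℛ : ∀ x : V, Submodule ℝ (TangentSpace (𝓡 n) x)) : Prop :=
  ∃ (_ : LieRing (InvariantSection ℛ)) (_ : LieAlgebra ℝ (InvariantSection ℛ))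
    (_ : Module (invariantFunctions ℛ) (InvariantSection ℛ))
    (_ : LieRingModule (InvariantSection ℛ) (invariantFunctions ℛ))
    (_ : LieRinehartRing (invariantFunctions ℛ) (InvariantSection ℛ)),
    LieRinehartAlgebra ℝ (invariantFunctions ℛ) (InvariantSection ℛ) ∧
    (∀ (s t : InvariantSection ℛ) (x : V), (s + t).val x = s.val x + t.val x) ∧
    (∀ (r : ℝ) (s : InvariantSection ℛ) (x : V), (r • s).val x = r • s.val x) ∧
    (∀ (f : invariantFunctions ℛ) (s : InvariantSection ℛ) (x : V),
      (f • s).val x = (f : C^∞⟮𝓡 n, V; ℝ⟯) x • s.val x) ∧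
    (∀ (s t : InvariantSection ℛ) (U : Set V) (X Y : ∀ x : V, TangentSpace (𝓡 n) x),
      IsOpen U → SmoothFieldOn X U → SmoothFieldOn Y U →
      Represents X s.val U → Represents Y t.val U →
        Represents (VectorField.mlieBracket (𝓡 n) X Y) (⁅s, t⁆ : InvariantSection ℛ).val U) ∧
    (∀ (s : InvariantSection ℛ) (f : invariantFunctions ℛ) (x : V) (v : TangentSpace (𝓡 n) x),
      (ℛ x).mkQ v = s.val x →
        ((⁅s, f⁆ : invariantFunctions ℛ) : C^∞⟮𝓡 n, V; ℝ⟯) x =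
          mfderiv (𝓡 n) 𝓘(ℝ, ℝ) (f : C^∞⟮𝓡 n, V; ℝ⟯) x v)

/-! ### Contact forms -/

/-- Up to a positive factor depending only on `p`, the value of `η ∧ (dη)^p` at the point `x` on
`2p+1` tangent vectors. -/
def contactWedge (p : ℕ) (η : ∀ x : V, TangentSpace (𝓡 n) x →L[ℝ] ℝ) (x : V)
    (v : Fin (2 * p + 1) → TangentSpace (𝓡 n) x) : ℝ :=
  ∑ σ : Equiv.Perm (Fin (2 * p + 1)), ((Equiv.Perm.sign σ : ℤ) : ℝ) *
    (η x (v (σ 0)) * ∏ i : Fin p,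
      extDerivForm η x (v (σ ⟨2 * i + 1, by omega⟩)) (v (σ ⟨2 * i + 2, by omega⟩)))

/-- `η` is a contact form on the manifold `V` of dimension `n = 2p+1`: it is smooth and
`η ∧ (dη)^p` does not vanish at any point. -/
structure IsContactForm (p : ℕ)
    (η : ∀ x : V, TangentSpace (𝓡 n) x →L[ℝ] ℝ) : Prop where
  dim : n = 2 * p + 1
  smooth : SmoothFormOn η univ
  ne_zero : ∀ x : V, ∃ v, contactWedge p η x v ≠ 0

/-- `R` is the Reeb field of the one-form `η`. -/
structure IsReebField (η : ∀ x : V, TangentSpace (𝓡 n) x →L[ℝ] ℝ)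
    (R : ∀ x : V, TangentSpace (𝓡 n) x) : Prop where
  smooth : SmoothFieldOn R univ
  apply_eq_one : ∀ x : V, η x (R x) = 1
  extDeriv_eq_zero : ∀ (x : V) (v : TangentSpace (𝓡 n) x), extDerivForm η x (R x) v = 0

/-- The distribution of lines (subbundle of `TV`) generated by the vector field `R`. -/
def lineDistribution (R : ∀ x : V, TangentSpace (𝓡 n) x) (x : V) :
    Submodule ℝ (TangentSpace (𝓡 n) x) :=
  Submodule.span ℝ {R x}

/-! ### Pfaffian systems -/

/-- `P` is a Pfaffian system of rank `p`: a smooth subbundle of rank `p` of the cotangent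
bundle. -/
def IsPfaffianSystem (p : ℕ)
    (P : ∀ x : V, Submodule ℝ (TangentSpace (𝓡 n) x →L[ℝ] ℝ)) : Prop :=
  ∀ x : V, ∃ U : Set V, IsOpen U ∧ x ∈ U ∧
    ∃ α : Fin p → ∀ y : V, TangentSpace (𝓡 n) y →L[ℝ] ℝ,
      (∀ i, SmoothFormOn (α i) U) ∧
      ∀ y ∈ U, LinearIndependent ℝ (fun i => α i y) ∧
        P y = Submodule.span ℝ (range fun i => α i y)

/-- The characteristic system of `P` at `x`: the space of linear forms on `T_x V` generated by
`P x` and by the contractions of `dα`, for `α` a local section of `P`, with the vectors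
annihilated by `P x`. -/
def characteristicSystem
    (P : ∀ x : V, Submodule ℝ (TangentSpace (𝓡 n) x →L[ℝ] ℝ)) (x : V) :
    Submodule ℝ (TangentSpace (𝓡 n) x →L[ℝ] ℝ) :=
  P x ⊔ Submodule.span ℝ
    {β | ∃ (U : Set V) (α : ∀ y : V, TangentSpace (𝓡 n) y →L[ℝ] ℝ) (v : TangentSpace (𝓡 n) x),
      IsOpen U ∧ x ∈ U ∧ SmoothFormOn α U ∧ (∀ y ∈ U, α y ∈ P y) ∧
      (∀ γ ∈ P x, γ v = 0) ∧ β = extDerivForm α x v}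

/-- The class of `P` at the point `x`, in the sense of É. Cartan. -/
def pfaffianClass
    (P : ∀ x : V, Submodule ℝ (TangentSpace (𝓡 n) x →L[ℝ] ℝ)) (x : V) : ℕ :=
  Module.finrank ℝ (characteristicSystem P x)

/-- There is a `q`-dimensional integral submanifold of `P` through `x`, given here by a local
parametrization `g`. -/
def HasIntegralSubmanifoldAt (P : ∀ x : V, Submodule ℝ (TangentSpace (𝓡 n) x →L[ℝ] ℝ))
    (q : ℕ) (x : V) : Prop :=
  ∃ (D : Set (EuclideanSpace ℝ (Fin q))) (g : EuclideanSpace ℝ (Fin q) → V),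
    IsOpen D ∧ 0 ∈ D ∧ g 0 = x ∧ ContMDiffOn (𝓡 q) (𝓡 n) ∞ g D ∧
    ∀ u ∈ D, Function.Injective (mfderiv (𝓡 q) (𝓡 n) g u) ∧
      ∀ α ∈ P (g u), ∀ w, α (mfderiv (𝓡 q) (𝓡 n) g u w) = 0

/-- `P` is a `p`-contact system: a Pfaffian system of rank `p` and of maximal class `n`
having integral submanifolds of the maximal dimension `q = p (n - p) / (p + 1)` through every
point. -/
structure IsPContactSystem (p : ℕ)
    (P : ∀ x : V, Submodule ℝ (TangentSpace (𝓡 n) x →L[ℝ] ℝ)) : Prop where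
  pfaffian : IsPfaffianSystem p P
  class_eq : ∀ x : V, pfaffianClass P x = n
  integral : ∃ q : ℕ, (q : ℤ) * (p + 1) = p * ((n : ℤ) - p) ∧
    ∀ x : V, HasIntegralSubmanifoldAt P q x

/-- The differential at `y` of the `k`-th coordinate function of the chart `φ`. -/
def coordForm (φ : OpenPartialHomeomorph V (EuclideanSpace ℝ (Fin n))) (k : Fin n) (y : V) :
    TangentSpace (𝓡 n) y →L[ℝ] ℝ :=
  mfderiv (𝓡 n) 𝓘(ℝ, ℝ) (fun z => φ z k) y

/-- The `k`-th coordinate vector field of the chart `φ`, at the point `y`. -/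
def coordField (φ : OpenPartialHomeomorph V (EuclideanSpace ℝ (Fin n))) (k : Fin n) (y : V) :
    TangentSpace (𝓡 n) y :=
  let dφ : TangentSpace (𝓡 n) y →L[ℝ] EuclideanSpace ℝ (Fin n) := mfderiv (𝓡 n) (𝓡 n) φ y
  dφ.inverse (EuclideanSpace.single k 1)

/-- `φ` is a Darboux chart of `P`. Its coordinates are labelled (through the bijection `e`) as
`x i`, `y j` and `z j i` for `i < p` and `j < m`; and `P` is generated in it by the forms
`α i = d(x i) + ∑ j, z j i • d(y j)`. -/
structure IsDarbouxChart {p m : ℕ} (P : ∀ x : V, Submodule ℝ (TangentSpace (𝓡 n) x →L[ℝ] ℝ))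
    (e : Fin p ⊕ Fin m ⊕ (Fin m × Fin p) ≃ Fin n)
    (φ : OpenPartialHomeomorph V (EuclideanSpace ℝ (Fin n))) : Prop where
  mem_atlas : φ ∈ IsManifold.maximalAtlas (𝓡 n) ∞ V
  eq_span : ∀ y ∈ φ.source, P y = Submodule.span ℝ (range fun i : Fin p =>
    coordForm φ (e (.inl i)) y +
      ∑ j : Fin m, (φ y (e (.inr (.inr (j, i)))) : ℝ) • coordForm φ (e (.inr (.inl j))) y)

/-- `ℛ` is a distribution on `V` which around every point is generated by the fields
`∂/∂(x i)`, `i < p`, of some Darboux chart of `P`. -/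
def IsDarbouxDistribution (p m : ℕ) (P : ∀ x : V, Submodule ℝ (TangentSpace (𝓡 n) x →L[ℝ] ℝ))
    (ℛ : ∀ x : V, Submodule ℝ (TangentSpace (𝓡 n) x)) : Prop :=
  ∀ x : V, ∃ (e : Fin p ⊕ Fin m ⊕ (Fin m × Fin p) ≃ Fin n)
    (φ : OpenPartialHomeomorph V (EuclideanSpace ℝ (Fin n))),
    x ∈ φ.source ∧ IsDarbouxChart P e φ ∧
      ∀ y ∈ φ.source, ℛ y = Submodule.span ℝ (range fun i : Fin p => coordField φ (e (.inl i)) y)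

end Basics

end LieRinehartContact

end

set_option linter.unusedSectionVars false

noncomputable section

namespace LieRinehartContact

/-! ### Derivatives along vector fields, smoothness, and the bracket as a commutator of derivations.
-/

section Calculus

open VectorField Filter Topology

variable {n : ℕ} {V : Type*} [TopologicalSpace V] [ChartedSpace (EuclideanSpace ℝ (Fin n)) V]

/-! Everything follows from involutivity: it suffices that `ℛ` is generated by its smooth local
sections and that these are closed under the bracket (`IsInvolutive`). Vector fields `X` with `[Z,
X]` in `ℛ` for every section `Z` of `ℛ` form the normalizer of the Lie algebra of sections of `ℛ`,
in which these sections are an ideal; an invariant section is locally a class in the quotient, which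
is a Lie algebra by the Jacobi identity. If moreover `Z(f) = 0` for all such `Z`, then `X(f)`
depends on the class of `X` only, and `Z(X(f)) = [Z, X](f) + X(Z(f)) = 0`, so `X(f)` is again
invariant. The remaining axioms are identities between vector fields and functions, checked on local
representatives. This is `inducesLieRinehart_of_isInvolutive`; its analytic ingredients are the
Jacobi identity and `fieldDeriv_mlieBracket`.

For a contact form, a section of the Reeb line is `g R` with smooth `g`, because `η(R) = 1` recovers
`g` as the value of `η`; and `[g R, h R]` is a multiple of `R`. For a Darboux distribution, `ℛ` is
locally the common kernel of the differentials of some coordinate functions, and two fields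
annihilating a function have a bracket annihilating it. -/

instance isManifold_infty_add_one [IsManifold (𝓡 n) ∞ V] :
    IsManifold (𝓡 n) (((⊤ : ℕ∞) : ℕ∞ω) + 1) V := by
  rw [show (((⊤ : ℕ∞) : ℕ∞ω) + 1) = ∞ from rfl]
  infer_instance

instance isManifold_minSmoothness_two [IsManifold (𝓡 n) ∞ V] :
    IsManifold (𝓡 n) (minSmoothness ℝ 2) V := by
  rw [minSmoothness_of_isRCLikeNormedField]
  infer_instance

instance isManifold_minSmoothness_three [IsManifold (𝓡 n) ∞ V] :
    IsManifold (𝓡 n) (minSmoothness ℝ 3) V := by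
  rw [minSmoothness_of_isRCLikeNormedField]
  infer_instance

variable {X Y Z : ∀ x : V, TangentSpace (𝓡 n) x} {f g : V → ℝ}
  {U W : Set V} {x : V}
  {φ : OpenPartialHomeomorph V (EuclideanSpace ℝ (Fin n))}

/-- The derivative `X(f)` of the function `f` along the vector field `X`. -/
def fieldDeriv (X : ∀ x : V, TangentSpace (𝓡 n) x) (f : V → ℝ) (x : V) : ℝ :=
  mvfderiv (𝓡 n) f x (X x)

lemma fieldDeriv_add (hf : MDifferentiableAt (𝓡 n) 𝓘(ℝ, ℝ) f x)
    (hg : MDifferentiableAt (𝓡 n) 𝓘(ℝ, ℝ) g x) :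
    fieldDeriv X (f + g) x = fieldDeriv X f x + fieldDeriv X g x := by
  simp [fieldDeriv, mvfderiv_add hf hg]

lemma fieldDeriv_mul (hf : MDifferentiableAt (𝓡 n) 𝓘(ℝ, ℝ) f x)
    (hg : MDifferentiableAt (𝓡 n) 𝓘(ℝ, ℝ) g x) :
    fieldDeriv X (f * g) x = f x * fieldDeriv X g x + g x * fieldDeriv X f x := by
  simp [fieldDeriv, mvfderiv_mul hf hg]

lemma fieldDeriv_congr (h : f =ᶠ[𝓝 x] g) : fieldDeriv X f x = fieldDeriv X g x := by
  simp only [fieldDeriv, mvfderiv]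
  rw [h.mfderiv_eq, h.eq_of_nhds]

/-- The vector field with constant coordinates `c` in the chart `φ`. -/
def constField (φ : OpenPartialHomeomorph V (EuclideanSpace ℝ (Fin n)))
    (c : EuclideanSpace ℝ (Fin n)) : ∀ x : V, TangentSpace (𝓡 n) x :=
  mpullback (𝓡 n) 𝓘(ℝ, EuclideanSpace ℝ (Fin n)) φ (fun _ => c)

lemma isInvertible_mfderiv_of_mem_maximalAtlas (hφ : φ ∈ IsManifold.maximalAtlas (𝓡 n) ∞ V)
    (hx : x ∈ φ.source) : (mfderiv (𝓡 n) (𝓡 n) φ x).IsInvertible :=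
  have h : φ.MDifferentiable (𝓡 n) (𝓡 n) :=
    ⟨(contMDiffOn_of_mem_maximalAtlas hφ).mdifferentiableOn (by simp),
      (contMDiffOn_symm_of_mem_maximalAtlas hφ).mdifferentiableOn (by simp)⟩
  ⟨h.mfderiv hx, rfl⟩

variable [IsManifold (𝓡 n) ∞ V]

lemma SmoothFieldOn.mono (hX : SmoothFieldOn X U) (h : W ⊆ U) : SmoothFieldOn X W :=
  ContMDiffOn.mono hX h

lemma SmoothFieldOn.contMDiffAt (hX : SmoothFieldOn X U) (hU : IsOpen U) (hx : x ∈ U) :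
    ContMDiffAt (𝓡 n) (𝓡 n).tangent ∞ (fun x => (⟨x, X x⟩ : TangentBundle (𝓡 n) V)) x :=
  ContMDiffOn.contMDiffAt hX (hU.mem_nhds hx)

lemma SmoothFieldOn.mdifferentiableAt (hX : SmoothFieldOn X U) (hU : IsOpen U) (hx : x ∈ U) :
    MDifferentiableAt (𝓡 n) (𝓡 n).tangent (fun x => (⟨x, X x⟩ : TangentBundle (𝓡 n) V)) x :=
  (hX.contMDiffAt hU hx).mdifferentiableAt (by simp)

lemma SmoothFieldOn.add (hX : SmoothFieldOn X U) (hY : SmoothFieldOn Y U) :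
    SmoothFieldOn (X + Y) U :=
  ContMDiffOn.add_section hX hY

lemma SmoothFieldOn.sub (hX : SmoothFieldOn X U) (hY : SmoothFieldOn Y U) :
    SmoothFieldOn (X - Y) U :=
  ContMDiffOn.sub_section hX hY

lemma SmoothFieldOn.smul (hf : ContMDiffOn (𝓡 n) 𝓘(ℝ, ℝ) ∞ f U) (hX : SmoothFieldOn X U) :
    SmoothFieldOn (f • X) U :=
  ContMDiffOn.smul_section hf hX

lemma SmoothFieldOn.const_smul (r : ℝ) (hX : SmoothFieldOn X U) : SmoothFieldOn (r • X) U :=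
  ContMDiffOn.const_smul_section hX

lemma smoothFieldOn_zero : SmoothFieldOn (0 : ∀ x : V, TangentSpace (𝓡 n) x) U :=
  (contMDiff_zeroSection ℝ (TangentSpace (𝓡 n) (M := V))).contMDiffOn

lemma SmoothFieldOn.mlieBracket (hU : IsOpen U) (hX : SmoothFieldOn X U)
    (hY : SmoothFieldOn Y U) : SmoothFieldOn (mlieBracket (𝓡 n) X Y) U := fun _ hx =>
  (ContMDiffAt.mlieBracket_vectorField (m := ⊤) (n := ⊤) (hX.contMDiffAt hU hx)
    (hY.contMDiffAt hU hx) (by simp)).contMDiffWithinAt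

lemma SmoothFieldOn.leibniz_identity_mlieBracket (hX : SmoothFieldOn X U)
    (hU : IsOpen U) (hx : x ∈ U) (hY : SmoothFieldOn Y U) (hZ : SmoothFieldOn Z U) :
    VectorField.mlieBracket (𝓡 n) X (VectorField.mlieBracket (𝓡 n) Y Z) x =
      VectorField.mlieBracket (𝓡 n) (VectorField.mlieBracket (𝓡 n) X Y) Z x
        + VectorField.mlieBracket (𝓡 n) Y (VectorField.mlieBracket (𝓡 n) X Z) x := by
  have h : minSmoothness ℝ 2 ≤ ∞ := by
    rw [minSmoothness_of_isRCLikeNormedField]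
    exact ENat.LEInfty.out
  exact leibniz_identity_mlieBracket_apply ((hX.contMDiffAt hU hx).of_le h)
    ((hY.contMDiffAt hU hx).of_le h) ((hZ.contMDiffAt hU hx).of_le h)

lemma contMDiffOn_fieldDeriv (hU : IsOpen U) (hX : SmoothFieldOn X U)
    (hf : ContMDiffOn (𝓡 n) 𝓘(ℝ, ℝ) ∞ f U) :
    ContMDiffOn (𝓡 n) 𝓘(ℝ, ℝ) ∞ (fieldDeriv X f) U := by
  intro x hx
  have hfx := hf.contMDiffAt (hU.mem_nhds hx)
  -- The number `X(f)` is the fibre component of the tangent vector `df(X)` of `ℝ`, based at `f y`;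
  -- smoothness is proved in the tangent bundle of `ℝ` and then projected.
  have h : ContMDiffAt (𝓡 n) 𝓘(ℝ, ℝ).tangent ∞
      (fun y => (⟨f y, mfderiv (𝓡 n) 𝓘(ℝ, ℝ) f y (X y)⟩ : TangentBundle 𝓘(ℝ, ℝ) ℝ)) x :=
    ContMDiffAt.clm_apply_of_inCoordinates (hfx.mfderiv_const (m := ∞) le_rfl)
      (hX.contMDiffAt hU hx) hfx
  exact ((contMDiff_snd_tangentBundle_modelSpace ℝ 𝓘(ℝ, ℝ)).contMDiffAt.comp x h).contMDiffWithinAt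

lemma mlieBracket_smul_right_apply (hf : MDifferentiableAt (𝓡 n) 𝓘(ℝ, ℝ) f x)
    (hY : MDifferentiableAt (𝓡 n) (𝓡 n).tangent
      (fun x => (⟨x, Y x⟩ : TangentBundle (𝓡 n) V)) x) :
    VectorField.mlieBracket (𝓡 n) X (f • Y) x =
      fieldDeriv X f x • Y x + f x • VectorField.mlieBracket (𝓡 n) X Y x :=
  mlieBracket_smul_right hf hY

lemma smoothFieldOn_constField (hφ : φ ∈ IsManifold.maximalAtlas (𝓡 n) ∞ V)
    (c : EuclideanSpace ℝ (Fin n)) : SmoothFieldOn (constField φ c) φ.source := fun _ hx =>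
  (ContMDiffAt.mpullback_vectorField_preimage (m := ∞) (n := ∞)
    (contMDiffAt_vectorSpace_iff_contDiffAt.2 contDiffAt_const)
    (contMDiffAt_of_mem_maximalAtlas hφ hx)
    (isInvertible_mfderiv_of_mem_maximalAtlas hφ hx) le_rfl).contMDiffWithinAt

/-- Provides a smooth extension of any tangent vector at `x` to the chart domain. -/
lemma constField_mfderiv (hφ : φ ∈ IsManifold.maximalAtlas (𝓡 n) ∞ V) (hx : x ∈ φ.source)
    (v : TangentSpace (𝓡 n) x) : constField φ (mfderiv (𝓡 n) (𝓡 n) φ x v) x = v :=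
  (isInvertible_mfderiv_of_mem_maximalAtlas hφ hx).inverse_apply_self v

/-- The Lie bracket acts on functions as the commutator of derivations. It is enough to apply the
Jacobi identity to `X`, `Y` and `f • Z` for a field `Z` which does not vanish at the point. -/
lemma fieldDeriv_mlieBracket (hU : IsOpen U) (hx : x ∈ U) (hX : SmoothFieldOn X U)
    (hY : SmoothFieldOn Y U) (hf : ContMDiffOn (𝓡 n) 𝓘(ℝ, ℝ) ∞ f U) :
    fieldDeriv (mlieBracket (𝓡 n) X Y) f x =
      fieldDeriv X (fieldDeriv Y f) x - fieldDeriv Y (fieldDeriv X f) x := by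
  -- A nonzero vector is needed to cancel `Z x` at the end; in dimension zero all derivatives
  -- vanish.
  by_cases hv : ∃ v : TangentSpace (𝓡 n) x, v ≠ 0
  swap
  · push Not at hv
    have h0 : ∀ (W : ∀ x : V, TangentSpace (𝓡 n) x) (h : V → ℝ),
        fieldDeriv W h x = 0 := fun W h => by rw [fieldDeriv, hv (W x), map_zero]
    simp only [h0, sub_zero]
  obtain ⟨v, hv⟩ := hv
  wlog hUs : U ⊆ (chartAt (EuclideanSpace ℝ (Fin n)) x).source generalizing U
  · exact this (hU.inter (chartAt _ x).open_source) ⟨hx, mem_chart_source _ x⟩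
      (hX.mono inter_subset_left) (hY.mono inter_subset_left) (hf.mono inter_subset_left)
      inter_subset_right
  have hφ := IsManifold.chart_mem_maximalAtlas (I := 𝓡 n) (n := ∞) x
  set Z := constField (chartAt (EuclideanSpace ℝ (Fin n)) x)
    (mfderiv (𝓡 n) (𝓡 n) (chartAt (EuclideanSpace ℝ (Fin n)) x) x v)
  have hZx : Z x = v := constField_mfderiv hφ (mem_chart_source _ x) v
  have hZ : SmoothFieldOn Z U := (smoothFieldOn_constField hφ _).mono hUs
  have md : ∀ {g : V → ℝ}, ContMDiffOn (𝓡 n) 𝓘(ℝ, ℝ) ∞ g U → ∀ {y}, y ∈ U →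
      MDifferentiableAt (𝓡 n) 𝓘(ℝ, ℝ) g y := fun hg y hy =>
    (hg.contMDiffAt (hU.mem_nhds hy)).mdifferentiableAt (by simp)
  -- Two applications of the Leibniz rule. The two middle terms, of first order in `f`, are
  -- exchanged when `A` and `B` are.
  have key : ∀ {A B : ∀ x : V, TangentSpace (𝓡 n) x}, SmoothFieldOn A U → SmoothFieldOn B U →
      mlieBracket (𝓡 n) A (mlieBracket (𝓡 n) B (f • Z)) x =
        fieldDeriv A (fieldDeriv B f) x • Z x
          + fieldDeriv B f x • mlieBracket (𝓡 n) A Z x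
          + (fieldDeriv A f x • mlieBracket (𝓡 n) B Z x
          + f x • mlieBracket (𝓡 n) A (mlieBracket (𝓡 n) B Z) x) := by
    intro A B hA hB
    have e : mlieBracket (𝓡 n) B (f • Z) =ᶠ[𝓝 x]
        (fieldDeriv B f • Z + f • mlieBracket (𝓡 n) B Z : ∀ x : V, TangentSpace (𝓡 n) x) := by
      filter_upwards [hU.mem_nhds hx] with y hy
      exact mlieBracket_smul_right_apply (md hf hy) (hZ.mdifferentiableAt hU hy)
    have hBf := contMDiffOn_fieldDeriv hU hB hf
    have hBZ := hB.mlieBracket hU hZ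
    rw [(EventuallyEq.refl (𝓝 x) A).mlieBracket_vectorField_eq e,
      mlieBracket_add_right ((hZ.smul hBf).mdifferentiableAt hU hx)
        ((hBZ.smul hf).mdifferentiableAt hU hx),
      mlieBracket_smul_right_apply (md hBf hx) (hZ.mdifferentiableAt hU hx),
      mlieBracket_smul_right_apply (md hf hx) (hBZ.mdifferentiableAt hU hx)]
  -- In the Jacobi identity for `f • Z` the first-order terms cancel by symmetry, and the terms with
  -- factor `f x` cancel by the Jacobi identity for `Z`. Only a multiple of `Z x` remains, whose
  -- coefficient is the claimed identity.
  have h1 := hX.leibniz_identity_mlieBracket hU hx hY (hZ.smul hf)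
  rw [key hX hY, key hY hX, hX.leibniz_identity_mlieBracket hU hx hY hZ,
    mlieBracket_smul_right_apply (md hf hx) (hZ.mdifferentiableAt hU hx)] at h1
  have h2 : (fieldDeriv X (fieldDeriv Y f) x - fieldDeriv Y (fieldDeriv X f) x
      - fieldDeriv (mlieBracket (𝓡 n) X Y) f x) • Z x = 0 := by
    rw [sub_smul, sub_smul, ← sub_eq_zero_of_eq h1]
    module
  rw [hZx, smul_eq_zero, or_iff_left hv] at h2
  linarith

end Calculus

/-! ### Involutive distributions and invariance of sections. -/

section Foliation

open VectorField Filter Topology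

variable {n : ℕ} {V : Type*} [TopologicalSpace V] [ChartedSpace (EuclideanSpace ℝ (Fin n)) V]
  [IsManifold (𝓡 n) ∞ V]

/-- `ℛ` is generated by its smooth local sections, and these are closed under the Lie bracket. -/
class IsInvolutive (ℛ : ∀ x : V, Submodule ℝ (TangentSpace (𝓡 n) x)) : Prop where
  exists_extension : ∀ x : V, ∀ v ∈ ℛ x, ∃ U : Set V, IsOpen U ∧ x ∈ U ∧
    ∃ Z : ∀ x : V, TangentSpace (𝓡 n) x, SmoothFieldOn Z U ∧ (∀ y ∈ U, Z y ∈ ℛ y) ∧ Z x = v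
  mlieBracket_mem : ∀ U : Set V, IsOpen U → ∀ Z W : (∀ x : V, TangentSpace (𝓡 n) x),
    SmoothFieldOn Z U → SmoothFieldOn W U → (∀ y ∈ U, Z y ∈ ℛ y) → (∀ y ∈ U, W y ∈ ℛ y) →
      ∀ y ∈ U, mlieBracket (𝓡 n) Z W y ∈ ℛ y

variable {ℛ : ∀ x : V, Submodule ℝ (TangentSpace (𝓡 n) x)}
  {X X' Y Y' Z : ∀ x : V, TangentSpace (𝓡 n) x} {U W : Set V} {x : V} {f : V → ℝ}
  {s t : ∀ x : V, TangentSpace (𝓡 n) x ⧸ ℛ x}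

lemma Represents.mono (h : Represents X s U) (hW : W ⊆ U) : Represents X s W :=
  fun y hy => h y (hW hy)

lemma Represents.sub_mem (h : Represents X s U) (h' : Represents X' s U) :
    ∀ y ∈ U, (X' - X) y ∈ ℛ y := fun y hy => by
  rw [← Submodule.ker_mkQ (ℛ y), LinearMap.mem_ker, Pi.sub_apply, map_sub, h y hy, h' y hy,
    sub_self]

/-- Invariance of a section has to be tested on one local representative only. -/
lemma isInvariantSection_of_local [IsInvolutive ℛ]
    (h : ∀ x : V, ∃ U : Set V, IsOpen U ∧ x ∈ U ∧ ∃ X : ∀ x : V, TangentSpace (𝓡 n) x,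
      SmoothFieldOn X U ∧ Represents X s U ∧
      ∀ (W : Set V) (Z : ∀ x : V, TangentSpace (𝓡 n) x), IsOpen W → x ∈ W → W ⊆ U →
        SmoothFieldOn Z W → (∀ y ∈ W, Z y ∈ ℛ y) → mlieBracket (𝓡 n) Z X x ∈ ℛ x) :
    IsInvariantSection s := by
  intro U' hU' X' Z hX' hZ hr' hZm y hy
  obtain ⟨U, hU, hyU, X, hX, hr, hi⟩ := h y
  have hW : IsOpen (U' ∩ U) := hU'.inter hU
  have hyW : y ∈ U' ∩ U := ⟨hy, hyU⟩
  have hXW := hX.mono (W := U' ∩ U) inter_subset_right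
  have hXW' := hX'.mono (W := U' ∩ U) inter_subset_left
  have hZW := hZ.mono (W := U' ∩ U) inter_subset_left
  have hZmW : ∀ z ∈ U' ∩ U, Z z ∈ ℛ z := fun z hz => hZm z hz.1
  -- Write `X' = X + (X' - X)`: the difference is a section of `ℛ`, so involutivity handles its
  -- bracket with `Z`.
  rw [← add_sub_cancel X X', mlieBracket_add_right (hXW.mdifferentiableAt hW hyW)
    ((hXW'.sub hXW).mdifferentiableAt hW hyW)]
  exact add_mem (hi _ Z hW hyW inter_subset_right hZW hZmW)
    (IsInvolutive.mlieBracket_mem _ hW Z _ hZW (hXW'.sub hXW) hZmW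
      ((hr.mono inter_subset_right).sub_mem (hr'.mono inter_subset_left)) y hyW)

/-! ### The Lie-Rinehart structure on invariant sections and functions. -/

namespace InvariantSection

lemma ext_val {s t : InvariantSection ℛ} (h : ∀ x, s.val x = t.val x) : s = t := by
  cases s
  cases t
  congr
  exact funext h

/-- `X` is a smooth vector field on the open set `U` which represents the invariant
section `s`. -/
structure IsLift (X : ∀ x : V, TangentSpace (𝓡 n) x) (s : InvariantSection ℛ) (U : Set V) :
    Prop where
  isOpen : IsOpen U
  smooth : SmoothFieldOn X U
  represents : Represents X s.val U

lemma exists_isLift (s : InvariantSection ℛ) (x : V) :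
    ∃ (U : Set V) (X : ∀ x : V, TangentSpace (𝓡 n) x), x ∈ U ∧ IsLift X s U :=
  let ⟨U, hU, hx, X, hX, h⟩ := s.smooth x
  ⟨U, X, hx, hU, hX, h⟩

variable {s t u : InvariantSection ℛ}

lemma IsLift.mono (h : IsLift X s U) (hW : IsOpen W) (hWU : W ⊆ U) : IsLift X s W :=
  ⟨hW, h.smooth.mono hWU, h.represents.mono hWU⟩

lemma IsLift.val_eq (h : IsLift X s U) (hx : x ∈ U) : s.val x = (ℛ x).mkQ (X x) :=
  (h.represents x hx).symm

lemma IsLift.mdifferentiableAt (h : IsLift X s U) (hx : x ∈ U) :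
    MDifferentiableAt (𝓡 n) (𝓡 n).tangent (fun x => (⟨x, X x⟩ : TangentBundle (𝓡 n) V)) x :=
  h.smooth.mdifferentiableAt h.isOpen hx

lemma exists_isLift₂ (s t : InvariantSection ℛ) (x : V) :
    ∃ (U : Set V) (X Y : ∀ x : V, TangentSpace (𝓡 n) x), x ∈ U ∧ IsLift X s U ∧ IsLift Y t U :=
  let ⟨U, X, hx, hX⟩ := s.exists_isLift x
  let ⟨U', Y, hx', hY⟩ := t.exists_isLift x
  ⟨U ∩ U', X, Y, ⟨hx, hx'⟩, hX.mono (hX.isOpen.inter hY.isOpen) inter_subset_left,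
    hY.mono (hX.isOpen.inter hY.isOpen) inter_subset_right⟩

lemma exists_isLift₃ (s t u : InvariantSection ℛ) (x : V) :
    ∃ (U : Set V) (X Y Z : ∀ x : V, TangentSpace (𝓡 n) x), x ∈ U ∧
      IsLift X s U ∧ IsLift Y t U ∧ IsLift Z u U :=
  let ⟨U, X, Y, hx, hX, hY⟩ := s.exists_isLift₂ t x
  let ⟨U', Z, hx', hZ⟩ := u.exists_isLift x
  have hU := hX.isOpen.inter hZ.isOpen
  ⟨U ∩ U', X, Y, Z, ⟨hx, hx'⟩, hX.mono hU inter_subset_left, hY.mono hU inter_subset_left,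
    hZ.mono hU inter_subset_right⟩

lemma IsLift.mlieBracket_mem (h : IsLift X s U) (hW : IsOpen W) (hWU : W ⊆ U)
    (hZ : SmoothFieldOn Z W) (hZm : ∀ y ∈ W, Z y ∈ ℛ y) : ∀ y ∈ W, mlieBracket (𝓡 n) Z X y ∈ ℛ y :=
  s.invariant W hW X Z (h.smooth.mono hWU) hZ (h.represents.mono hWU) hZm

variable [IsInvolutive ℛ]

/-- The invariant section with given local representatives. -/
def ofLocal (s : ∀ x : V, TangentSpace (𝓡 n) x ⧸ ℛ x)
    (h : ∀ x : V, ∃ U : Set V, IsOpen U ∧ x ∈ U ∧ ∃ X : ∀ x : V, TangentSpace (𝓡 n) x,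
      SmoothFieldOn X U ∧ Represents X s U ∧
      ∀ (W : Set V) (Z : ∀ x : V, TangentSpace (𝓡 n) x), IsOpen W → x ∈ W → W ⊆ U →
        SmoothFieldOn Z W → (∀ y ∈ W, Z y ∈ ℛ y) → mlieBracket (𝓡 n) Z X x ∈ ℛ x) :
    InvariantSection ℛ where
  val := s
  smooth x := let ⟨U, hU, hx, X, hX, hr, _⟩ := h x; ⟨U, hU, hx, X, hX, hr⟩
  invariant := isInvariantSection_of_local h

instance : Zero (InvariantSection ℛ) where
  zero := ofLocal (fun _ => 0) fun _ => ⟨univ, isOpen_univ, mem_univ _, 0, smoothFieldOn_zero,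
    fun _ _ => map_zero _, fun _ _ _ _ _ _ _ => by
      rw [mlieBracket_zero_right]
      exact zero_mem _⟩

instance : Add (InvariantSection ℛ) where
  add s t := ofLocal (fun x => s.val x + t.val x) fun x => by
    obtain ⟨U, X, Y, hx, hX, hY⟩ := s.exists_isLift₂ t x
    refine ⟨U, hX.isOpen, hx, X + Y, hX.smooth.add hY.smooth, fun y hy => ?_,
      fun W Z hW hxW hWU hZ hZm => ?_⟩
    · beta_reduce
      rw [hX.val_eq hy, hY.val_eq hy, Pi.add_apply, map_add]
    · rw [mlieBracket_add_right (hX.mdifferentiableAt hx) (hY.mdifferentiableAt hx)]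
      exact add_mem (hX.mlieBracket_mem hW hWU hZ hZm x hxW) (hY.mlieBracket_mem hW hWU hZ hZm x hxW)

instance : SMul ℝ (InvariantSection ℛ) where
  smul r s := ofLocal (fun x => r • s.val x) fun x => by
    obtain ⟨U, X, hx, hX⟩ := s.exists_isLift x
    refine ⟨U, hX.isOpen, hx, r • X, hX.smooth.const_smul r, fun y hy => ?_,
      fun W Z hW hxW hWU hZ hZm => ?_⟩
    · beta_reduce
      rw [hX.val_eq hy, Pi.smul_apply, map_smul]
    · rw [mlieBracket_const_smul_right (hX.mdifferentiableAt hx)]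
      exact Submodule.smul_mem _ _ (hX.mlieBracket_mem hW hWU hZ hZm x hxW)

instance : SMul (invariantFunctions ℛ) (InvariantSection ℛ) where
  smul f s := ofLocal (fun x => (f : C^∞⟮𝓡 n, V; ℝ⟯) x • s.val x) fun x => by
    obtain ⟨U, X, hx, hX⟩ := s.exists_isLift x
    refine ⟨U, hX.isOpen, hx, ⇑(f : C^∞⟮𝓡 n, V; ℝ⟯) • X, hX.smooth.smul f.1.contMDiff.contMDiffOn,
      fun y hy => ?_, fun W Z hW hxW hWU hZ hZm => ?_⟩
    · beta_reduce
      rw [hX.val_eq hy, Pi.smul_apply', map_smul]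
    -- In `[Z, f X] = Z(f) X + f [Z, X]` the first term vanishes because `f` is constant along `ℛ`.
    · rw [mlieBracket_smul_right_apply (f.1.contMDiff.mdifferentiableAt (by simp))
        (hX.mdifferentiableAt hx), show fieldDeriv Z f.1 x = 0 from f.2 x _ (hZm x hxW), zero_smul,
        zero_add]
      exact Submodule.smul_mem _ _ (hX.mlieBracket_mem hW hWU hZ hZm x hxW)

@[simp] lemma val_zero (x : V) : (0 : InvariantSection ℛ).val x = 0 := rfl

@[simp] lemma val_add (s t : InvariantSection ℛ) (x : V) :
    (s + t).val x = s.val x + t.val x := rfl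

@[simp] lemma val_smul (r : ℝ) (s : InvariantSection ℛ) (x : V) : (r • s).val x = r • s.val x := rfl

@[simp] lemma val_function_smul (f : invariantFunctions ℛ) (s : InvariantSection ℛ) (x : V) :
    (f • s).val x = (f : C^∞⟮𝓡 n, V; ℝ⟯) x • s.val x := rfl

instance : Neg (InvariantSection ℛ) where
  neg s := (-1 : ℝ) • s

@[simp] lemma val_neg (s : InvariantSection ℛ) (x : V) : (-s).val x = -s.val x :=
  neg_one_smul ℝ (s.val x)

instance : AddCommGroup (InvariantSection ℛ) where
  add_assoc s t u := ext_val fun x => add_assoc (s.val x) (t.val x) (u.val x)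
  zero_add s := ext_val fun x => zero_add (s.val x)
  add_zero s := ext_val fun x => add_zero (s.val x)
  add_comm s t := ext_val fun x => add_comm (s.val x) (t.val x)
  neg_add_cancel s := ext_val fun x => by simp
  nsmul := nsmulRec
  zsmul := zsmulRec

instance : Module ℝ (InvariantSection ℛ) where
  one_smul s := ext_val fun x => one_smul ℝ (s.val x)
  mul_smul a b s := ext_val fun x => mul_smul a b (s.val x)
  smul_zero a := ext_val fun x => smul_zero (A := TangentSpace (𝓡 n) x ⧸ ℛ x) a
  smul_add a s t := ext_val fun x => smul_add a (s.val x) (t.val x)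
  add_smul a b s := ext_val fun x => add_smul a b (s.val x)
  zero_smul s := ext_val fun x => zero_smul ℝ (s.val x)

instance : Module (invariantFunctions ℛ) (InvariantSection ℛ) where
  one_smul s := ext_val fun x => one_smul ℝ (s.val x)
  mul_smul a b s := ext_val fun x => mul_smul (a.1 x) (b.1 x) (s.val x)
  smul_zero a := ext_val fun x => smul_zero (A := TangentSpace (𝓡 n) x ⧸ ℛ x) (a.1 x)
  smul_add a s t := ext_val fun x => smul_add (a.1 x) (s.val x) (t.val x)
  add_smul a b s := ext_val fun x => add_smul (a.1 x) (b.1 x) (s.val x)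
  zero_smul s := ext_val fun x => zero_smul ℝ (s.val x)

/-- The class of `[X, Y]` depends on the invariant sections represented by `X` and `Y` only. -/
lemma IsLift.mkQ_mlieBracket_eq (hX : IsLift X s U) (hY : IsLift Y t U) (hX' : IsLift X' s W)
    (hY' : IsLift Y' t W) (hx : x ∈ U) (hx' : x ∈ W) :
    (ℛ x).mkQ (mlieBracket (𝓡 n) X Y x) = (ℛ x).mkQ (mlieBracket (𝓡 n) X' Y' x) := by
  wlog h : U = W generalizing U W
  · have hUW := hX.isOpen.inter hX'.isOpen
    exact this (hX.mono hUW inter_subset_left) (hY.mono hUW inter_subset_left)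
      (hX'.mono hUW inter_subset_right) (hY'.mono hUW inter_subset_right) ⟨hx, hx'⟩ ⟨hx, hx'⟩ rfl
  subst h
  -- `[X, Y] - [X', Y'] = [Y' - Y, X] - [X' - X, Y']`. Both differences are sections of `ℛ`, so
  -- invariance of `s` and of `t` puts the two brackets in `ℛ`.
  have h1 := hY'.mlieBracket_mem hX.isOpen subset_rfl (hX'.smooth.sub hX.smooth)
    (hX.represents.sub_mem hX'.represents) x hx
  have h2 := hX.mlieBracket_mem hX.isOpen subset_rfl (hY'.smooth.sub hY.smooth)
    (hY.represents.sub_mem hY'.represents) x hx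
  have e1 := mlieBracket_add_left (I := 𝓡 n) (W := Y') (hX.mdifferentiableAt hx)
    ((hX'.smooth.sub hX.smooth).mdifferentiableAt hX.isOpen hx)
  have e2 := mlieBracket_add_right (I := 𝓡 n) (V := X) (hY.mdifferentiableAt hx)
    ((hY'.smooth.sub hY.smooth).mdifferentiableAt hX.isOpen hx)
  rw [add_sub_cancel] at e1 e2
  rw [← sub_eq_zero, ← map_sub, Submodule.mkQ_apply, Submodule.Quotient.mk_eq_zero, e1, e2,
    mlieBracket_swap_apply (V := X) (W := Y' - Y), sub_add_eq_sub_sub, sub_add_eq_sub_sub, sub_self,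
    zero_sub, neg_neg]
  exact sub_mem h2 h1

/-- The bracket of two invariant sections, computed with arbitrary representatives. -/
def bracketVal (s t : InvariantSection ℛ) (x : V) : TangentSpace (𝓡 n) x ⧸ ℛ x :=
  (ℛ x).mkQ (mlieBracket (𝓡 n) (s.exists_isLift₂ t x).choose_spec.choose
    (s.exists_isLift₂ t x).choose_spec.choose_spec.choose x)

/-- The representatives chosen in `bracketVal` vary with the point without coherence. Independence
of the choice lets one pair compute the bracket on a whole open set, which is what makes it smooth.
-/
lemma IsLift.bracketVal_eq (hX : IsLift X s U) (hY : IsLift Y t U) (hx : x ∈ U) :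
    bracketVal s t x = (ℛ x).mkQ (mlieBracket (𝓡 n) X Y x) := by
  obtain ⟨hx', hX', hY'⟩ := (s.exists_isLift₂ t x).choose_spec.choose_spec.choose_spec
  exact hX'.mkQ_mlieBracket_eq hY' hX hY hx' hx

instance : Bracket (InvariantSection ℛ) (InvariantSection ℛ) where
  bracket s t := ofLocal (bracketVal s t) fun x => by
    obtain ⟨U, X, Y, hx, hX, hY⟩ := s.exists_isLift₂ t x
    refine ⟨U, hX.isOpen, hx, mlieBracket (𝓡 n) X Y, hX.smooth.mlieBracket hX.isOpen hY.smooth,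
      fun y hy => (hX.bracketVal_eq hY hy).symm, fun W Z hW hxW hWU hZ hZm => ?_⟩
    -- `[Z, [X, Y]] = [[Z, X], Y] + [X, [Z, Y]]`: the inner brackets are sections of `ℛ` by
    -- invariance of `s` and `t`, and invariance then applies once more to each outer bracket.
    rw [hZ.leibniz_identity_mlieBracket hW hxW (hX.smooth.mono hWU) (hY.smooth.mono hWU),
      mlieBracket_swap_apply (V := X)]
    exact add_mem
      (hY.mlieBracket_mem hW hWU (hZ.mlieBracket hW (hX.smooth.mono hWU))
        (hX.mlieBracket_mem hW hWU hZ hZm) x hxW)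
      (neg_mem (hX.mlieBracket_mem hW hWU (hZ.mlieBracket hW (hY.smooth.mono hWU))
        (hY.mlieBracket_mem hW hWU hZ hZm) x hxW))

/-- Since lifts are compatible with all operations, each algebraic axiom reduces, at each point, to
the corresponding identity for vector fields on a common domain. -/
lemma IsLift.lie (hX : IsLift X s U) (hY : IsLift Y t U) :
    IsLift (mlieBracket (𝓡 n) X Y) ⁅s, t⁆ U :=
  ⟨hX.isOpen, hX.smooth.mlieBracket hX.isOpen hY.smooth,
    fun _ hy => (hX.bracketVal_eq hY hy).symm⟩

lemma IsLift.add (hX : IsLift X s U) (hY : IsLift Y t U) : IsLift (X + Y) (s + t) U :=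
  ⟨hX.isOpen, hX.smooth.add hY.smooth, fun y hy => by
    rw [val_add, hX.val_eq hy, hY.val_eq hy, Pi.add_apply, map_add]⟩

lemma IsLift.const_smul (r : ℝ) (hX : IsLift X s U) : IsLift (r • X) (r • s) U :=
  ⟨hX.isOpen, hX.smooth.const_smul r, fun y hy => by
    rw [val_smul, hX.val_eq hy, Pi.smul_apply, map_smul]⟩

lemma IsLift.function_smul (f : invariantFunctions ℛ) (hX : IsLift X s U) :
    IsLift (⇑(f : C^∞⟮𝓡 n, V; ℝ⟯) • X) (f • s) U :=
  ⟨hX.isOpen, hX.smooth.smul f.1.contMDiff.contMDiffOn, fun y hy => by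
    rw [val_function_smul, hX.val_eq hy, Pi.smul_apply', map_smul]⟩

instance : LieRing (InvariantSection ℛ) where
  add_lie s t u := ext_val fun x => by
    obtain ⟨U, X, Y, Z, hx, hX, hY, hZ⟩ := s.exists_isLift₃ t u x
    rw [((hX.add hY).lie hZ).val_eq hx, ((hX.lie hZ).add (hY.lie hZ)).val_eq hx,
      mlieBracket_add_left (hX.mdifferentiableAt hx) (hY.mdifferentiableAt hx), Pi.add_apply]
  lie_add s t u := ext_val fun x => by
    obtain ⟨U, X, Y, Z, hx, hX, hY, hZ⟩ := s.exists_isLift₃ t u x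
    rw [(hX.lie (hY.add hZ)).val_eq hx, ((hX.lie hY).add (hX.lie hZ)).val_eq hx,
      mlieBracket_add_right (hY.mdifferentiableAt hx) (hZ.mdifferentiableAt hx), Pi.add_apply]
  lie_self s := ext_val fun x => by
    obtain ⟨U, X, hx, hX⟩ := s.exists_isLift x
    rw [(hX.lie hX).val_eq hx, mlieBracket_self, Pi.zero_apply, map_zero, val_zero]
  leibniz_lie s t u := ext_val fun x => by
    obtain ⟨U, X, Y, Z, hx, hX, hY, hZ⟩ := s.exists_isLift₃ t u x
    rw [(hX.lie (hY.lie hZ)).val_eq hx,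
      (((hX.lie hY).lie hZ).add (hY.lie (hX.lie hZ))).val_eq hx,
      hX.smooth.leibniz_identity_mlieBracket hX.isOpen hx hY.smooth hZ.smooth, Pi.add_apply]

instance : LieAlgebra ℝ (InvariantSection ℛ) where
  lie_smul r s t := ext_val fun x => by
    obtain ⟨U, X, Y, hx, hX, hY⟩ := s.exists_isLift₂ t x
    rw [(hX.lie (hY.const_smul r)).val_eq hx, ((hX.lie hY).const_smul r).val_eq hx,
      mlieBracket_const_smul_right (hY.mdifferentiableAt hx), Pi.smul_apply]

/-- The derivative of an invariant function along an invariant section. -/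
def derivVal (s : InvariantSection ℛ) (f : invariantFunctions ℛ) (x : V) : ℝ :=
  (ℛ x).liftQ (mvfderiv (𝓡 n) (f : C^∞⟮𝓡 n, V; ℝ⟯) x).toLinearMap (fun v hv => f.2 x v hv) (s.val x)

lemma derivVal_eq (f : invariantFunctions ℛ) {v : TangentSpace (𝓡 n) x}
    (h : (ℛ x).mkQ v = s.val x) :
    derivVal s f x = mvfderiv (𝓡 n) (f : C^∞⟮𝓡 n, V; ℝ⟯) x v := by
  rw [derivVal, ← h]
  rfl

lemma IsLift.derivVal_eq (hX : IsLift X s U) (f : invariantFunctions ℛ) (hx : x ∈ U) :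
    derivVal s f x = fieldDeriv X (f : C^∞⟮𝓡 n, V; ℝ⟯) x :=
  InvariantSection.derivVal_eq f (hX.represents x hx)

lemma IsLift.derivVal_eventuallyEq (hX : IsLift X s U) (f : invariantFunctions ℛ) (hx : x ∈ U) :
    derivVal s f =ᶠ[𝓝 x] fieldDeriv X (f : C^∞⟮𝓡 n, V; ℝ⟯) := by
  filter_upwards [hX.isOpen.mem_nhds hx] with y hy using hX.derivVal_eq f hy

lemma contMDiff_derivVal (s : InvariantSection ℛ) (f : invariantFunctions ℛ) :
    ContMDiff (𝓡 n) 𝓘(ℝ, ℝ) ∞ (derivVal s f) := fun x => by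
  obtain ⟨U, X, hx, hX⟩ := s.exists_isLift x
  exact ((contMDiffOn_fieldDeriv hX.isOpen hX.smooth f.1.contMDiff.contMDiffOn).contMDiffAt
    (hX.isOpen.mem_nhds hx)).congr_of_eventuallyEq (hX.derivVal_eventuallyEq f hx)

/-- `Z(X(f)) = [Z, X](f) + X(Z(f))`, where `[Z, X]` lies in `ℛ` and `Z(f)` vanishes near the point.
The vector `v` must first be extended to a local section `Z` of `ℛ` for this formula to make sense.
-/
lemma mvfderiv_derivVal_eq_zero (s : InvariantSection ℛ) (f : invariantFunctions ℛ)
    {v : TangentSpace (𝓡 n) x} (hv : v ∈ ℛ x) : mvfderiv (𝓡 n) (derivVal s f) x v = 0 := by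
  obtain ⟨U, X, hx, hX⟩ := s.exists_isLift x
  obtain ⟨U', hU', hx', Z, hZ, hZm, rfl⟩ := IsInvolutive.exists_extension x v hv
  have hW := hX.isOpen.inter hU'
  have hZW := hZ.mono (W := U ∩ U') inter_subset_right
  have hZmW : ∀ y ∈ U ∩ U', Z y ∈ ℛ y := fun y hy => hZm y hy.2
  have h := fieldDeriv_mlieBracket hW ⟨hx, hx'⟩ hZW (hX.smooth.mono inter_subset_left)
    f.1.contMDiff.contMDiffOn
  have h0 : fieldDeriv (mlieBracket (𝓡 n) Z X) f.1 x = 0 :=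
    f.2 x _ (hX.mlieBracket_mem hW inter_subset_left hZW hZmW x ⟨hx, hx'⟩)
  have h1 : fieldDeriv Z f.1 =ᶠ[𝓝 x] fun _ => 0 := by
    filter_upwards [hW.mem_nhds ⟨hx, hx'⟩] with y hy using f.2 y _ (hZmW y hy)
  have h2 : fieldDeriv X (fieldDeriv Z f.1) x = 0 := by
    rw [fieldDeriv_congr h1, fieldDeriv, mvfderiv_const]
    rfl
  rw [h0, h2, sub_zero, ← fieldDeriv_congr (hX.derivVal_eventuallyEq f hx)] at h
  exact h.symm

instance : Bracket (InvariantSection ℛ) (invariantFunctions ℛ) where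
  bracket s f := ⟨⟨derivVal s f, contMDiff_derivVal s f⟩,
    fun _ _ hv => mvfderiv_derivVal_eq_zero s f hv⟩

lemma ext_function {f g : invariantFunctions ℛ}
    (h : ∀ x, (f : C^∞⟮𝓡 n, V; ℝ⟯) x = (g : C^∞⟮𝓡 n, V; ℝ⟯) x) : f = g :=
  Subtype.ext (ContMDiffMap.ext h)

lemma IsLift.lie_function_apply (hX : IsLift X s U) (f : invariantFunctions ℛ) (hx : x ∈ U) :
    ((⁅s, f⁆ : invariantFunctions ℛ) : C^∞⟮𝓡 n, V; ℝ⟯) x =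
      fieldDeriv X (f : C^∞⟮𝓡 n, V; ℝ⟯) x :=
  hX.derivVal_eq f hx

lemma mdifferentiableAt_function (f : invariantFunctions ℛ) (x : V) :
    MDifferentiableAt (𝓡 n) 𝓘(ℝ, ℝ) (f : C^∞⟮𝓡 n, V; ℝ⟯) x :=
  f.1.contMDiff.mdifferentiableAt (by simp)

instance : LieRingModule (InvariantSection ℛ) (invariantFunctions ℛ) where
  add_lie s t f := ext_function fun x =>
    map_add ((ℛ x).liftQ _ fun v hv => f.2 x v hv) (s.val x) (t.val x)
  lie_add s f g := ext_function fun x => by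
    obtain ⟨U, X, hx, hX⟩ := s.exists_isLift x
    change _ = ((⁅s, f⁆ : invariantFunctions ℛ) : C^∞⟮𝓡 n, V; ℝ⟯) x
      + ((⁅s, g⁆ : invariantFunctions ℛ) : C^∞⟮𝓡 n, V; ℝ⟯) x
    rw [hX.lie_function_apply _ hx, hX.lie_function_apply _ hx, hX.lie_function_apply _ hx]
    exact fieldDeriv_add (mdifferentiableAt_function f x) (mdifferentiableAt_function g x)
  leibniz_lie s t f := ext_function fun x => by
    obtain ⟨U, X, Y, hx, hX, hY⟩ := s.exists_isLift₂ t x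
    change _ = ((⁅⁅s, t⁆, f⁆ : invariantFunctions ℛ) : C^∞⟮𝓡 n, V; ℝ⟯) x
      + ((⁅t, ⁅s, f⁆⁆ : invariantFunctions ℛ) : C^∞⟮𝓡 n, V; ℝ⟯) x
    rw [hX.lie_function_apply _ hx, hY.lie_function_apply _ hx,
      (hX.lie hY).lie_function_apply _ hx,
      fieldDeriv_mlieBracket hX.isOpen hx hX.smooth hY.smooth f.1.contMDiff.contMDiffOn,
      ← fieldDeriv_congr (hX.derivVal_eventuallyEq f hx),
      ← fieldDeriv_congr (hY.derivVal_eventuallyEq f hx)]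
    exact (sub_add_cancel _ _).symm

instance : LieRinehartRing (invariantFunctions ℛ) (InvariantSection ℛ) where
  lie_smul_eq_mul' f g s := ext_function fun x =>
    map_smul ((ℛ x).liftQ _ fun v hv => g.2 x v hv) (f.1 x) (s.val x)
  leibniz_mul_right' s f g := ext_function fun x => by
    obtain ⟨U, X, hx, hX⟩ := s.exists_isLift x
    change _ = f.1 x * ((⁅s, g⁆ : invariantFunctions ℛ) : C^∞⟮𝓡 n, V; ℝ⟯) x
      + ((⁅s, f⁆ : invariantFunctions ℛ) : C^∞⟮𝓡 n, V; ℝ⟯) x * g.1 x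
    rw [hX.lie_function_apply _ hx, hX.lie_function_apply _ hx, hX.lie_function_apply _ hx,
      mul_comm _ (g.1 x)]
    exact fieldDeriv_mul (mdifferentiableAt_function f x) (mdifferentiableAt_function g x)
  leibniz_smul_right' s t f := ext_val fun x => by
    obtain ⟨U, X, Y, hx, hX, hY⟩ := s.exists_isLift₂ t x
    rw [(hX.lie (hY.function_smul f)).val_eq hx, val_add, val_function_smul, val_function_smul,
      (hX.lie hY).val_eq hx, hY.val_eq hx, hX.lie_function_apply _ hx,
      mlieBracket_smul_right_apply (mdifferentiableAt_function f x) (hY.mdifferentiableAt hx),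
      map_add, map_smul, map_smul, add_comm]

instance : LieRinehartAlgebra ℝ (invariantFunctions ℛ) (InvariantSection ℛ) where
  smul_assoc r f s := ext_val fun x => smul_assoc r (f.1 x) (s.val x)
  smul_lie r s f := ext_function fun x =>
    map_smul ((ℛ x).liftQ _ fun v hv => f.2 x v hv) r (s.val x)
  lie_smul r s f := ext_function fun x => by
    obtain ⟨U, X, hx, hX⟩ := s.exists_isLift x
    change _ = r * ((⁅s, f⁆ : invariantFunctions ℛ) : C^∞⟮𝓡 n, V; ℝ⟯) x
    rw [hX.lie_function_apply _ hx, hX.lie_function_apply _ hx]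
    -- A real scalar acts as a constant function, whose derivative term in the product rule
    -- vanishes.
    have h := fieldDeriv_mul (X := X) (x := x) (f := fun _ => r) mdifferentiableAt_const
      (mdifferentiableAt_function f x)
    rw [show fieldDeriv X (fun _ => r) x = 0 by rw [fieldDeriv, mvfderiv_const]; rfl, mul_zero,
      add_zero] at h
    exact h

end InvariantSection

lemma inducesLieRinehart_of_isInvolutive [IsInvolutive ℛ] : InducesLieRinehart ℛ :=
  ⟨inferInstance, inferInstance, inferInstance, inferInstance, inferInstance, inferInstance,
    fun _ _ _ => rfl, fun _ _ _ => rfl, fun _ _ _ => rfl,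
    fun _ _ _ _ _ hU hX hY hr hr' =>
      (InvariantSection.IsLift.lie ⟨hU, hX, hr⟩ ⟨hU, hY, hr'⟩).represents,
    fun _ f _ _ h => InvariantSection.derivVal_eq f h⟩

end Foliation

/-! ### Involutivity of the Reeb line distribution and of Darboux distributions. -/

section Examples

open VectorField Filter Topology

variable {n : ℕ} {V : Type*} [TopologicalSpace V] [ChartedSpace (EuclideanSpace ℝ (Fin n)) V]
  [IsManifold (𝓡 n) ∞ V] {U : Set V} {x : V}

lemma contMDiffOn_form_apply {α : ∀ x : V, TangentSpace (𝓡 n) x →L[ℝ] ℝ}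
    {X : ∀ x : V, TangentSpace (𝓡 n) x} (hα : SmoothFormOn α U) (hX : SmoothFieldOn X U) :
    ContMDiffOn (𝓡 n) 𝓘(ℝ, ℝ) ∞ (fun x => α x (X x)) U := fun x hx =>
  have h : ContMDiffOn (𝓡 n) ((𝓡 n).prod 𝓘(ℝ, ℝ)) ∞
      (fun x => TotalSpace.mk' ℝ (E := Bundle.Trivial V ℝ) x (α x (X x))) U :=
    ContMDiffOn.clm_bundle_apply (E₂ := Bundle.Trivial V ℝ) hα hX
  (contMDiffWithinAt_totalSpace.1 (h x hx)).2

/-- The line distribution of a smooth field `R` is involutive, if a smooth one-form takes the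
value `1` on `R`. -/
lemma isInvolutive_lineDistribution {η : ∀ x : V, TangentSpace (𝓡 n) x →L[ℝ] ℝ}
    {R : ∀ x : V, TangentSpace (𝓡 n) x} (hη : SmoothFormOn η univ) (hR : SmoothFieldOn R univ)
    (h : ∀ x, η x (R x) = 1) : IsInvolutive (lineDistribution R) where
  exists_extension x v hv := by
    obtain ⟨c, rfl⟩ := Submodule.mem_span_singleton.1 hv
    exact ⟨univ, isOpen_univ, mem_univ _, c • R, hR.const_smul c,
      fun y _ => Submodule.smul_mem _ _ (Submodule.mem_span_singleton_self _), rfl⟩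
  mlieBracket_mem U hU Z W hZ hW hZm hWm y hy := by
    -- Membership in the line gives a coefficient at each point separately; `η` identifies it as
    -- `η(X)`, which is smooth.
    have key : ∀ {X : ∀ x : V, TangentSpace (𝓡 n) x}, (∀ y ∈ U, X y ∈ lineDistribution R y) →
        X =ᶠ[𝓝 y] ((fun x => η x (X x)) • R : ∀ x : V, TangentSpace (𝓡 n) x) := fun {X} hX => by
      filter_upwards [hU.mem_nhds hy] with z hz
      obtain ⟨c, hc⟩ := Submodule.mem_span_singleton.1 (hX z hz)
      rw [Pi.smul_apply', ← hc, map_smul, h, smul_eq_mul, mul_one]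
    have md : ∀ {X : ∀ x : V, TangentSpace (𝓡 n) x}, SmoothFieldOn X U →
        MDifferentiableAt (𝓡 n) 𝓘(ℝ, ℝ) (fun x => η x (X x)) y := fun hX =>
      ((contMDiffOn_form_apply (hη.mono (subset_univ U)) hX).contMDiffAt
        (hU.mem_nhds hy)).mdifferentiableAt (by simp)
    have hRy := hR.mdifferentiableAt isOpen_univ (mem_univ y)
    have hmem : R y ∈ lineDistribution R y := Submodule.mem_span_singleton_self _
    rw [(key hZm).mlieBracket_vectorField_eq (key hWm), mlieBracket_smul_right_apply (md hW) hRy,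
      mlieBracket_swap_apply (V := (fun x => η x (Z x)) • R),
      mlieBracket_smul_right_apply (md hZ) hRy, mlieBracket_self]
    refine add_mem (Submodule.smul_mem _ _ hmem) (Submodule.smul_mem _ _ (neg_mem (add_mem
      (Submodule.smul_mem _ _ hmem) (Submodule.smul_mem _ _ (zero_mem _)))))

variable {φ : OpenPartialHomeomorph V (EuclideanSpace ℝ (Fin n))} {S : Set (Fin n)}

/-- The derivative of the chart `φ` at `x`, with values in the model space. -/
def chartDeriv (φ : OpenPartialHomeomorph V (EuclideanSpace ℝ (Fin n))) (x : V) :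
    TangentSpace (𝓡 n) x →L[ℝ] EuclideanSpace ℝ (Fin n) :=
  mfderiv (𝓡 n) (𝓡 n) φ x

lemma chartDeriv_constField (hφ : φ ∈ IsManifold.maximalAtlas (𝓡 n) ∞ V) (hx : x ∈ φ.source)
    (c : EuclideanSpace ℝ (Fin n)) : chartDeriv φ x (constField φ c x) = c :=
  (isInvertible_mfderiv_of_mem_maximalAtlas hφ hx).self_apply_inverse c

/-- Trades generators for equations: in the form of vanishing coordinate components, membership can
be tested by differentiating functions. -/
lemma mem_span_coordField_iff (hφ : φ ∈ IsManifold.maximalAtlas (𝓡 n) ∞ V) (hx : x ∈ φ.source)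
    (v : TangentSpace (𝓡 n) x) :
    v ∈ Submodule.span ℝ ((fun k => coordField φ k x) '' S) ↔
      ∀ k ∉ S, chartDeriv φ x v k = 0 := by
  have hL : ∀ k, chartDeriv φ x (coordField φ k x) = EuclideanSpace.single k 1 := fun k =>
    chartDeriv_constField hφ hx _
  have hinj : Function.Injective (chartDeriv φ x) :=
    (isInvertible_mfderiv_of_mem_maximalAtlas hφ hx).injective
  constructor
  · intro hv k hk
    induction hv using Submodule.span_induction with
    | mem w hw =>
      obtain ⟨i, hi, rfl⟩ := hw
      have hki : k ≠ i := fun h => hk (h ▸ hi)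
      simp [hL, hki]
    | zero => simp
    | add a b _ _ ha hb => simp [ha, hb]
    | smul c a _ ha => simp [ha]
  · intro h
    have hv : v = ∑ k, chartDeriv φ x v k • coordField φ k x := by
      apply hinj
      rw [map_sum]
      simp only [map_smul, hL]
      ext i
      simp [Finset.sum_apply, Pi.single_apply]
    rw [hv]
    refine Submodule.sum_mem _ fun k _ => ?_
    by_cases hk : k ∈ S
    · exact Submodule.smul_mem _ _ (Submodule.subset_span ⟨k, hk, rfl⟩)
    · rw [h k hk, zero_smul]
      exact zero_mem _

lemma contMDiffOn_coord (hφ : φ ∈ IsManifold.maximalAtlas (𝓡 n) ∞ V) (k : Fin n) :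
    ContMDiffOn (𝓡 n) 𝓘(ℝ, ℝ) ∞ (fun z => φ z k) φ.source :=
  (EuclideanSpace.proj (𝕜 := ℝ) k : EuclideanSpace ℝ (Fin n) →L[ℝ] ℝ).contMDiff.comp_contMDiffOn
    (contMDiffOn_of_mem_maximalAtlas hφ)

/-- Makes the components of a bracket in the chart accessible to `fieldDeriv_mlieBracket`. -/
lemma fieldDeriv_coord (hφ : φ ∈ IsManifold.maximalAtlas (𝓡 n) ∞ V) (hx : x ∈ φ.source)
    (X : ∀ x : V, TangentSpace (𝓡 n) x) (k : Fin n) :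
    fieldDeriv X (fun z => φ z k) x = chartDeriv φ x (X x) k := by
  have h := (EuclideanSpace.proj (𝕜 := ℝ) k : EuclideanSpace ℝ (Fin n) →L[ℝ] ℝ).hasMFDerivAt.comp x
    ((contMDiffAt_of_mem_maximalAtlas hφ hx).mdifferentiableAt (by simp)).hasMFDerivAt
  exact congrArg (fun L : TangentSpace (𝓡 n) x →L[ℝ] ℝ => L (X x)) h.mfderiv

/-- A distribution which is locally generated by some of the coordinate fields of a chart is
involutive. -/
lemma isInvolutive_of_coordField {ℛ : ∀ x : V, Submodule ℝ (TangentSpace (𝓡 n) x)}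
    (h : ∀ x : V, ∃ (S : Set (Fin n)) (φ : OpenPartialHomeomorph V (EuclideanSpace ℝ (Fin n))),
      x ∈ φ.source ∧ φ ∈ IsManifold.maximalAtlas (𝓡 n) ∞ V ∧
      ∀ y ∈ φ.source, ℛ y = Submodule.span ℝ ((fun k => coordField φ k y) '' S)) :
    IsInvolutive ℛ where
  exists_extension x v hv := by
    obtain ⟨S, φ, hx, hφ, hS⟩ := h x
    rw [hS x hx, mem_span_coordField_iff hφ hx] at hv
    -- Extending `v` with constant coordinates keeps the components outside `S` zero on the whole
    -- chart domain.
    refine ⟨φ.source, φ.open_source, hx, constField φ (chartDeriv φ x v),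
      smoothFieldOn_constField hφ _, fun y hy => ?_, constField_mfderiv hφ hx v⟩
    rw [hS y hy, mem_span_coordField_iff hφ hy, chartDeriv_constField hφ hy]
    exact hv
  mlieBracket_mem U hU Z W hZ hW hZm hWm x hx := by
    obtain ⟨S, φ, hxφ, hφ, hS⟩ := h x
    have hUφ := hU.inter φ.open_source
    rw [hS x hxφ, mem_span_coordField_iff hφ hxφ]
    intro k hk
    -- For `k` outside `S`, a section of `ℛ` annihilates the `k`-th coordinate on a neighbourhood of
    -- `x`, so both terms of the commutator vanish at `x`.
    have h0 : ∀ {A B : ∀ x : V, TangentSpace (𝓡 n) x}, (∀ y ∈ U, B y ∈ ℛ y) →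
        fieldDeriv A (fieldDeriv B fun z => φ z k) x = 0 := fun {A B} hB => by
      have e : (fieldDeriv B fun z => φ z k) =ᶠ[𝓝 x] fun _ => 0 := by
        filter_upwards [hUφ.mem_nhds ⟨hx, hxφ⟩] with y hy
        rw [fieldDeriv_coord hφ hy.2]
        exact (mem_span_coordField_iff hφ hy.2 _).1 (hS y hy.2 ▸ hB y hy.1) k hk
      rw [fieldDeriv_congr e, fieldDeriv, mvfderiv_const]
      rfl
    rw [← fieldDeriv_coord hφ hxφ, fieldDeriv_mlieBracket hUφ ⟨hx, hxφ⟩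
      (hZ.mono inter_subset_left) (hW.mono inter_subset_left)
      ((contMDiffOn_coord hφ k).mono inter_subset_right), h0 hWm, h0 hZm, sub_zero]

lemma IsDarbouxDistribution.isInvolutive {p m : ℕ}
    {P : ∀ x : V, Submodule ℝ (TangentSpace (𝓡 n) x →L[ℝ] ℝ)}
    {ℛ : ∀ x : V, Submodule ℝ (TangentSpace (𝓡 n) x)} (h : IsDarbouxDistribution p m P ℛ) :
    IsInvolutive ℛ :=
  isInvolutive_of_coordField fun x => by
    obtain ⟨e, φ, hx, hφ, hℛ⟩ := h x
    refine ⟨range fun i : Fin p => e (.inl i), φ, hx, hφ.mem_atlas, fun y hy => ?_⟩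
    rw [hℛ y hy, ← range_comp]
    rfl

end Examples

end LieRinehartContact

end

theorem mainTheorem8 {n : ℕ} {V : Type*} [TopologicalSpace V]
    [ChartedSpace (EuclideanSpace ℝ (Fin n)) V] [IsManifold (𝓡 n) ∞ V] :
    (∀ (p : ℕ) (η : ∀ x : V, TangentSpace (𝓡 n) x →L[ℝ] ℝ) (R : ∀ x : V, TangentSpace (𝓡 n) x),
      LieRinehartContact.IsContactForm p η → LieRinehartContact.IsReebField η R →
        LieRinehartContact.InducesLieRinehart (LieRinehartContact.lineDistribution R)) ∧
    (∀ (p m : ℕ) (P : ∀ x : V, Submodule ℝ (TangentSpace (𝓡 n) x →L[ℝ] ℝ))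
      (ℛ : ∀ x : V, Submodule ℝ (TangentSpace (𝓡 n) x)),
      LieRinehartContact.IsPContactSystem p P →
      LieRinehartContact.IsDarbouxDistribution p m P ℛ →
        LieRinehartContact.InducesLieRinehart ℛ) := by
  refine ⟨fun p η R hη hR => ?_, fun p m P ℛ _ hℛ => ?_⟩
  · have := LieRinehartContact.isInvolutive_lineDistribution hη.smooth hR.smooth hR.apply_eq_one
    exact LieRinehartContact.inducesLieRinehart_of_isInvolutive
  · have := hℛ.isInvolutive
    exact LieRinehartContact.inducesLieRinehart_of_isInvolutive
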